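/- Let $\psi=(\log\Gamma)'$ denote the digamma function on $(0,\infty)$. Call a function $g:(0,\infty)\to\mathbb R$ completely monotonic if it is infinitely often differentiable and $(-1)^n g^{(n)}(x)\ge 0$ for all $n=0,1,2,\ldots$ and all $x>0$. For $\lambda>0$, let $\mathcal B_\lambda$ (the generalized Bernstein functions of order $\lambda$) be the class of $C^\infty$-functions $f:(0,\infty)\to(0,\infty)$ for which $x\mapsto x^{1-\lambda}f'(x)$ is completely monotonic. Let $a,b$ be real numbers with $0<b<a-1$. Then the function $F_{a,b}:(0,\infty)\to\mathbb R$ defined by $$F_{a,b}(x)=\frac{x^{a-b-1}}{\psi(x+a)-\psi(x+b)}$$ belongs to $\mathcal B_{a-b}$. -/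

import Mathlib

open Set
open scoped ContDiff

noncomputable section

/-- The digamma (psi) function on the real line, `ψ = (log Γ)'`. Used only on `(0, ∞)`, where
`Γ` is positive and differentiable. -/
def psi (x : ℝ) : ℝ := deriv (fun y : ℝ => Real.log (Real.Gamma y)) x

/-- On `(0, ∞)`, `psi` agrees with the complex digamma function. -/
theorem psi_eq_digamma {x : ℝ} (hx : 0 < x) : ((psi x : ℝ) : ℂ) = Complex.digamma (x : ℂ) := by
  have hne : ∀ m : ℕ, x ≠ -(m : ℝ) := fun m h => by
    have : (0 : ℝ) ≤ m := m.cast_nonneg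
    linarith
  have hneC : ∀ m : ℕ, (x : ℂ) ≠ -(m : ℂ) := fun m h => hne m (by exact_mod_cast h)
  have hd := Real.differentiableAt_Gamma hne
  have hC : HasDerivAt (fun y : ℝ => ((Real.Gamma y : ℝ) : ℂ)) (deriv Complex.Gamma (x : ℂ)) x := by
    simpa only [Complex.Gamma_ofReal] using
      (Complex.differentiableAt_Gamma (x : ℂ) hneC).hasDerivAt.comp_ofReal
  have heq : ((deriv Real.Gamma x : ℝ) : ℂ) = deriv Complex.Gamma (x : ℂ) :=
    hd.hasDerivAt.ofReal_comp.unique hC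
  rw [psi, (hd.hasDerivAt.log (Real.Gamma_pos_of_pos hx).ne').deriv, Complex.digamma_def,
    logDeriv_apply, Complex.Gamma_ofReal, ← heq]
  push_cast
  rfl

/-- Complete monotonicity of (the restriction to `(0, ∞)` of) `f`: `f` is smooth there and
`(-1)ⁿ f⁽ⁿ⁾(x) ≥ 0` for all `n ≥ 0` and `x > 0`. -/
def IsCompletelyMonotonic (f : ℝ → ℝ) : Prop :=
  ContDiffOn ℝ ∞ f (Ioi 0) ∧
    ∀ n : ℕ, ∀ x : ℝ, 0 < x → 0 ≤ (-1 : ℝ) ^ n * iteratedDerivWithin n f (Ioi 0) x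

/-- The class `𝓑_lam` of generalized Bernstein functions of order `lam > 0`: (restrictions to
`(0, ∞)` of) functions `f` that are smooth and positive on `(0, ∞)` and for which
`x ^ (1 - lam) * f'(x)` is completely monotonic. -/
structure IsGeneralizedBernstein (lam : ℝ) (f : ℝ → ℝ) : Prop where
  order_pos : 0 < lam
  contDiffOn : ContDiffOn ℝ ∞ f (Ioi 0)
  pos : ∀ x : ℝ, 0 < x → 0 < f x
  completelyMonotonic : IsCompletelyMonotonic (fun x : ℝ => x ^ (1 - lam) * deriv f x)

/-- `F_{a,b}(x) = x ^ (a - b - 1) / (ψ(x + a) - ψ(x + b))`, considered for `x > 0`. -/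
def psiQuotient (a b : ℝ) (x : ℝ) : ℝ := x ^ (a - b - 1) / (psi (x + a) - psi (x + b))

end

/-! Put `l = a - b > 1` and `G(x) = 1 / (ψ(x+b+l) - ψ(x+b))`. Then `F = x^(l-1) G` and `x^(1-l) F' =
G' + (l-1) G/x`, so it suffices that `G'` and `G/x` are completely monotonic.

The difference `ψ(x+b+l) - ψ(x+b)` is the Laplace transform of `psiDensity`, which is positive,
decreasing and log-convex when `b ≥ 0` and `l ≥ 1`. Its Riemann sum of step `ε` is `ε` times a power
series in `z = e^{-εx}` with coefficients of the same kind. By Kaluza's theorem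
(`invCoeff_succ_nonpos`) the reciprocal series has coefficients `≤ 0` beyond the constant term, and
monotonicity makes their partial sums `≥ 0` (`sum_range_invCoeff_nonneg`). The first fact gives the
sign pattern of `G'`; the second, after multiplication by `1/(1-z)`, that of `G/x`.

Letting `ε → 0` gives only pointwise convergence. Complete monotonicity is therefore carried through
iterated differences, and derivatives are recovered at the end from the smoothness of `G`. -/

open Filter Topology

/-! ### Complete monotonicity through iterated differences -/

/-- All iterated differences `f x - f (x + δ)` of order `n` of `f`, with arbitrary positive steps,
are nonnegative on `(0, ∞)`. -/
def AltDiffNonneg : ℕ → (ℝ → ℝ) → Prop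
  | 0, f => ∀ x, 0 < x → 0 ≤ f x
  | n + 1, f => ∀ δ, 0 < δ → AltDiffNonneg n (fun x => f x - f (x + δ))

namespace AltDiffNonneg

/-- An iterated difference involves finitely many values, so pointwise convergence is enough; no
control of derivatives is needed. -/
theorem of_tendsto {ι : Type*} {l : Filter ι} [l.NeBot] {n : ℕ} {F : ι → ℝ → ℝ} {f : ℝ → ℝ}
    (hF : ∀ᶠ i in l, AltDiffNonneg n (F i))
    (hlim : ∀ x, 0 < x → Tendsto (fun i => F i x) l (𝓝 (f x))) : AltDiffNonneg n f := by
  induction n generalizing F f with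
  | zero => exact fun x hx => ge_of_tendsto (hlim x hx) (hF.mono fun i hi => hi x hx)
  | succ n ih =>
    exact fun δ hδ => ih (hF.mono fun i hi => hi δ hδ)
      fun x hx => (hlim x hx).sub (hlim (x + δ) (by positivity))

theorem congr {n : ℕ} {f g : ℝ → ℝ} (hf : AltDiffNonneg n f) (h : ∀ x, 0 < x → f x = g x) :
    AltDiffNonneg n g :=
  of_tendsto (l := (atTop : Filter ℕ)) (F := fun _ => f) (Eventually.of_forall fun _ => hf)
    fun x hx => (h x hx) ▸ tendsto_const_nhds

theorem zero (n : ℕ) : AltDiffNonneg n (fun _ => 0) := by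
  induction n with
  | zero => exact fun _ _ => le_rfl
  | succ n ih => intro δ _; simpa using ih

theorem add {n : ℕ} {f g : ℝ → ℝ} (hf : AltDiffNonneg n f) (hg : AltDiffNonneg n g) :
    AltDiffNonneg n (fun x => f x + g x) := by
  induction n generalizing f g with
  | zero => exact fun x hx => add_nonneg (hf x hx) (hg x hx)
  | succ n ih =>
    exact fun δ hδ => (ih (hf δ hδ) (hg δ hδ)).congr fun x _ => by ring

theorem const_mul {n : ℕ} {f : ℝ → ℝ} {c : ℝ} (hc : 0 ≤ c) (hf : AltDiffNonneg n f) :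
    AltDiffNonneg n (fun x => c * f x) := by
  induction n generalizing f with
  | zero => exact fun x hx => mul_nonneg hc (hf x hx)
  | succ n ih => exact fun δ hδ => (ih (hf δ hδ)).congr fun x _ => by ring

theorem sum {ι : Type*} {n : ℕ} {F : ι → ℝ → ℝ} (s : Finset ι) (hF : ∀ i, AltDiffNonneg n (F i)) :
    AltDiffNonneg n (fun x => ∑ i ∈ s, F i x) := by
  classical
  induction s using Finset.induction_on with
  | empty => simpa using zero n
  | insert i s hi ih => simpa only [Finset.sum_insert hi] using (hF i).add ih

theorem of_hasSum {ι : Type*} {n : ℕ} {F : ι → ℝ → ℝ} {f : ℝ → ℝ}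
    (hF : ∀ i, AltDiffNonneg n (F i)) (hsum : ∀ x, 0 < x → HasSum (fun i => F i x) (f x)) :
    AltDiffNonneg n f :=
  of_tendsto (l := atTop) (F := fun s x => ∑ i ∈ s, F i x)
    (Eventually.of_forall fun s => sum s hF) hsum

theorem exp_neg_mul (n : ℕ) {s : ℝ} (hs : 0 ≤ s) : AltDiffNonneg n (fun x => Real.exp (-(s * x))) := by
  induction n with
  | zero => exact fun x _ => (Real.exp_pos _).le
  | succ n ih =>
    intro δ hδ
    have h : 0 ≤ 1 - Real.exp (-(s * δ)) :=
      sub_nonneg.2 (Real.exp_le_one_iff.2 (neg_nonpos.2 (by positivity)))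
    refine (ih.const_mul h).congr fun x _ => ?_
    simp only [mul_add, neg_add, Real.exp_add]
    ring

theorem deriv_of_increments {f : ℝ → ℝ} {n : ℕ}
    (hf : ∀ δ, 0 < δ → AltDiffNonneg n (fun x => f (x + δ) - f x))
    (hd : ∀ x, 0 < x → DifferentiableAt ℝ f x) : AltDiffNonneg n (deriv f) := by
  refine of_tendsto (l := 𝓝[>] (0 : ℝ)) (F := fun δ x => δ⁻¹ * (f (x + δ) - f x)) ?_ ?_
  · filter_upwards [self_mem_nhdsWithin] with δ (hδ : 0 < δ)
    exact (hf δ hδ).const_mul (by positivity)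
  · intro x hx
    have h := (hd x hx).hasDerivAt.tendsto_slope_zero_right
    simpa using h

theorem neg_deriv {f : ℝ → ℝ} {n : ℕ} (hf : AltDiffNonneg (n + 1) f)
    (hd : ∀ x, 0 < x → DifferentiableAt ℝ f x) : AltDiffNonneg n (fun x => -deriv f x) := by
  have h : AltDiffNonneg n (deriv fun x => -f x) :=
    deriv_of_increments (fun δ hδ => (hf δ hδ).congr fun x _ => by ring) fun x hx => (hd x hx).neg
  exact h.congr fun x _ => deriv.fun_neg

end AltDiffNonneg

/-- Induction on the order of the derivative, passing from `f` to `-f'`. This costs one order of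
differences, which is harmless because all orders are assumed. -/
theorem isCompletelyMonotonic_of_altDiffNonneg {f : ℝ → ℝ} (hf : ContDiffOn ℝ ∞ f (Ioi 0))
    (h : ∀ n, AltDiffNonneg n f) : IsCompletelyMonotonic f := by
  refine ⟨hf, fun n => ?_⟩
  induction n generalizing f with
  | zero => intro x hx; simpa using h 0 x hx
  | succ n ih =>
    intro x hx
    have hd : ∀ x, 0 < x → DifferentiableAt ℝ f x := fun y hy =>
      (hf.differentiableOn (by simp)).differentiableAt (Ioi_mem_nhds hy)
    have hsmooth : ContDiffOn ℝ ∞ (fun x => -deriv f x) (Ioi 0) :=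
      (hf.deriv_of_isOpen isOpen_Ioi (by simp)).neg
    have key := ih hsmooth (fun m => (h (m + 1)).neg_deriv hd) x hx
    rw [iteratedDerivWithin_succ', iteratedDerivWithin_congr
      (g := deriv f) (fun y hy => derivWithin_of_isOpen isOpen_Ioi hy) hx]
    rw [iteratedDerivWithin_fun_neg] at key
    rw [pow_succ]
    linarith

/-! ### Reciprocals of power series with log-convex coefficients -/

/-- The coefficients of the reciprocal of the formal power series `∑ aₙ zⁿ`. -/
noncomputable def invCoeff (a : ℕ → ℝ) (n : ℕ) : ℝ := PowerSeries.coeff n (PowerSeries.mk a)⁻¹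

theorem sum_antidiagonal_mul_invCoeff {a : ℕ → ℝ} (h0 : a 0 ≠ 0) (n : ℕ) :
    ∑ p ∈ Finset.HasAntidiagonal.antidiagonal n, a p.1 * invCoeff a p.2 = if n = 0 then 1 else 0 := by
  have h : PowerSeries.mk a * (PowerSeries.mk a)⁻¹ = 1 :=
    PowerSeries.mul_inv_cancel _ (by simpa using h0)
  have := congrArg (PowerSeries.coeff n) h
  simpa [PowerSeries.coeff_mul, PowerSeries.coeff_one, invCoeff] using this

theorem sum_range_mul_invCoeff {a : ℕ → ℝ} (h0 : a 0 ≠ 0) (n : ℕ) :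
    ∑ k ∈ Finset.range (n + 1), a (n - k) * invCoeff a k = if n = 0 then 1 else 0 := by
  rw [← sum_antidiagonal_mul_invCoeff h0 n, ← Finset.Nat.sum_antidiagonal_swap,
    Finset.Nat.sum_antidiagonal_eq_sum_range_succ_mk]
  rfl

theorem invCoeff_zero (a : ℕ → ℝ) : invCoeff a 0 = (a 0)⁻¹ := by
  simp [invCoeff]

theorem ratio_le_ratio_of_logConvex {a : ℕ → ℝ} (ha : ∀ n, 0 < a n)
    (hlog : ∀ n, a (n + 1) ^ 2 ≤ a n * a (n + 2)) :
    Monotone fun n => a (n + 1) / a n := by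
  refine monotone_nat_of_le_succ fun n => ?_
  rw [div_le_div_iff₀ (ha _) (ha _)]
  nlinarith [hlog n]

/-- Kaluza's theorem: the reciprocal of a power series with log-convex coefficients has
nonpositive coefficients in positive degrees. -/
theorem invCoeff_succ_nonpos {a : ℕ → ℝ} (ha : ∀ n, 0 < a n)
    (hlog : ∀ n, a (n + 1) ^ 2 ≤ a n * a (n + 2)) (n : ℕ) : invCoeff a (n + 1) ≤ 0 := by
  induction n using Nat.strong_induction_on with
  | _ n ih =>
    have hs := sum_range_mul_invCoeff (ha 0).ne' (n + 1)
    rw [Finset.sum_range_succ, if_neg n.succ_ne_zero, Nat.sub_self] at hs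
    suffices h : 0 ≤ ∑ k ∈ Finset.range (n + 1), a (n + 1 - k) * invCoeff a k by
      by_contra! hc
      linarith [mul_pos (ha 0) hc]
    have hmono := ratio_le_ratio_of_logConvex ha hlog
    -- The convolution identity at `n` is rescaled so that its `k = 0` term matches the one at `n +
    -- 1`. For `k ≥ 1` the ratios `a (n+1-k) / a (n-k)` are at most `a (n+1) / a n`, and the sign of
    -- `invCoeff a k` reverses the inequality.
    have hle : a (n + 1) / a n * ∑ k ∈ Finset.range (n + 1), a (n - k) * invCoeff a k ≤
        ∑ k ∈ Finset.range (n + 1), a (n + 1 - k) * invCoeff a k := by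
      rw [Finset.mul_sum]
      refine Finset.sum_le_sum fun k hk => ?_
      have hkn : k ≤ n := Nat.lt_succ_iff.1 (Finset.mem_range.1 hk)
      rw [← mul_assoc]
      rcases k with _ | k
      · simp [(ha n).ne']
      · have hr := hmono (Nat.sub_le n (k + 1))
        simp only at hr
        rw [div_le_iff₀ (ha _), show n - (k + 1) + 1 = n + 1 - (k + 1) by omega] at hr
        exact mul_le_mul_of_nonpos_right hr (ih k (by omega))
    refine le_trans ?_ hle
    rw [sum_range_mul_invCoeff (ha 0).ne']
    have := ha n
    have := ha (n + 1)
    split_ifs <;> positivity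

/-- In the convolution identity, replacing `a (n - k)` by the smaller `a n` only increases the sum,
since the coefficients with `k ≥ 1` are nonpositive. -/
theorem sum_range_invCoeff_nonneg {a : ℕ → ℝ} (ha : ∀ n, 0 < a n)
    (hlog : ∀ n, a (n + 1) ^ 2 ≤ a n * a (n + 2)) (hanti : Antitone a) (n : ℕ) :
    0 ≤ ∑ k ∈ Finset.range (n + 1), invCoeff a k := by
  have hle : ∑ k ∈ Finset.range (n + 1), a (n - k) * invCoeff a k ≤
      a n * ∑ k ∈ Finset.range (n + 1), invCoeff a k := by
    rw [Finset.mul_sum]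
    refine Finset.sum_le_sum fun k _ => ?_
    rcases k with _ | k
    · simp
    · exact mul_le_mul_of_nonpos_right (hanti (Nat.sub_le _ _)) (invCoeff_succ_nonpos ha hlog k)
  rw [sum_range_mul_invCoeff (ha 0).ne'] at hle
  refine nonneg_of_mul_nonneg_right (le_trans ?_ hle) (ha n)
  split_ifs <;> norm_num

theorem sum_range_invCoeff_le {a : ℕ → ℝ} (ha : ∀ n, 0 < a n)
    (hlog : ∀ n, a (n + 1) ^ 2 ≤ a n * a (n + 2)) (n : ℕ) :
    ∑ k ∈ Finset.range (n + 1), invCoeff a k ≤ (a 0)⁻¹ := by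
  rw [Finset.sum_range_succ', invCoeff_zero]
  have := Finset.sum_nonpos fun k (_ : k ∈ Finset.range n) => invCoeff_succ_nonpos ha hlog k
  linarith

/-- The partial sums lie in `[0, 1 / a 0]`, which bounds each increment. This gives absolute
convergence on `[0, 1)`. -/
theorem abs_invCoeff_le {a : ℕ → ℝ} (ha : ∀ n, 0 < a n)
    (hlog : ∀ n, a (n + 1) ^ 2 ≤ a n * a (n + 2)) (hanti : Antitone a) (n : ℕ) :
    |invCoeff a n| ≤ (a 0)⁻¹ := by
  have h0 := inv_pos.2 (ha 0)
  rcases n with _ | n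
  · rw [invCoeff_zero, abs_of_pos h0]
  · have h1 := sum_range_invCoeff_nonneg ha hlog hanti (n + 1)
    have h2 := sum_range_invCoeff_le ha hlog n
    rw [Finset.sum_range_succ] at h1
    rw [abs_of_nonpos (invCoeff_succ_nonpos ha hlog n)]
    linarith

theorem summable_mul_pow_of_abs_le {c : ℕ → ℝ} {C z : ℝ} (hc : ∀ n, |c n| ≤ C) (hz : 0 ≤ z)
    (hz1 : z < 1) : Summable fun n => ‖c n * z ^ n‖ := by
  refine Summable.of_nonneg_of_le (fun _ => norm_nonneg _) (fun n => ?_)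
    ((summable_geometric_of_lt_one hz hz1).mul_left C)
  rw [norm_mul, Real.norm_eq_abs, norm_pow, Real.norm_of_nonneg hz]
  exact mul_le_mul_of_nonneg_right (hc n) (by positivity)

theorem hasSum_mul_of_antidiagonal {c d e : ℕ → ℝ} {z : ℝ}
    (hc : Summable fun n => ‖c n * z ^ n‖) (hd : Summable fun n => ‖d n * z ^ n‖)
    (he : ∀ n, ∑ p ∈ Finset.HasAntidiagonal.antidiagonal n, c p.1 * d p.2 = e n) :
    HasSum (fun n => e n * z ^ n) ((∑' n, c n * z ^ n) * ∑' n, d n * z ^ n) := by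
  have heq : (fun n => e n * z ^ n) =
      fun n => ∑ p ∈ Finset.HasAntidiagonal.antidiagonal n, c p.1 * z ^ p.1 * (d p.2 * z ^ p.2) := by
    funext n
    rw [← he n, Finset.sum_mul]
    refine Finset.sum_congr rfl fun p hp => ?_
    rw [← Finset.HasAntidiagonal.mem_antidiagonal.1 hp, pow_add]
    ring
  rw [heq, tsum_mul_tsum_eq_tsum_sum_antidiagonal_of_summable_norm hc hd]
  exact (summable_norm_sum_mul_antidiagonal_of_summable_norm hc hd).of_norm.hasSum

theorem hasSum_invCoeff {a : ℕ → ℝ} (ha : ∀ n, 0 < a n)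
    (hlog : ∀ n, a (n + 1) ^ 2 ≤ a n * a (n + 2)) (hanti : Antitone a) {z : ℝ} (hz : 0 ≤ z)
    (hz1 : z < 1) : HasSum (fun n => invCoeff a n * z ^ n) (∑' n, a n * z ^ n)⁻¹ := by
  have hA : Summable fun n => ‖a n * z ^ n‖ :=
    summable_mul_pow_of_abs_le (C := a 0)
      (fun n => by rw [abs_of_pos (ha n)]; exact hanti n.zero_le) hz hz1
  have hC := summable_mul_pow_of_abs_le (abs_invCoeff_le ha hlog hanti) hz hz1
  have h1 := hasSum_mul_of_antidiagonal hA hC (sum_antidiagonal_mul_invCoeff (ha 0).ne')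
  have h2 : HasSum (fun n : ℕ => (if n = 0 then (1 : ℝ) else 0) * z ^ n) 1 := by
    convert hasSum_ite_eq (0 : ℕ) (1 : ℝ) using 2 with n
    split_ifs with h <;> simp [h]
  rw [inv_eq_of_mul_eq_one_right (h1.unique h2)]
  exact hC.of_norm.hasSum

theorem hasSum_sum_range_invCoeff {a : ℕ → ℝ} (ha : ∀ n, 0 < a n)
    (hlog : ∀ n, a (n + 1) ^ 2 ≤ a n * a (n + 2)) (hanti : Antitone a) {z : ℝ} (hz : 0 ≤ z)
    (hz1 : z < 1) :
    HasSum (fun n => (∑ k ∈ Finset.range (n + 1), invCoeff a k) * z ^ n)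
      ((∑' n, a n * z ^ n)⁻¹ * (1 - z)⁻¹) := by
  have hC := summable_mul_pow_of_abs_le (abs_invCoeff_le ha hlog hanti) hz hz1
  have hone := summable_mul_pow_of_abs_le (c := fun _ => 1) (C := 1) (by simp) hz hz1
  have h := hasSum_mul_of_antidiagonal (e := fun n => ∑ k ∈ Finset.range (n + 1), invCoeff a k)
    hC hone fun n => by
      rw [Finset.Nat.sum_antidiagonal_eq_sum_range_succ_mk]; simp
  simpa only [one_mul, tsum_geometric_of_lt_one hz hz1, (hasSum_invCoeff ha hlog hanti hz hz1).tsum_eq]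
    using h

/-! ### Smoothness of the digamma function and the series for its differences -/

theorem contDiffOn_real_Gamma : ContDiffOn ℝ ∞ Real.Gamma (Ioi 0) := by
  have hd : DifferentiableOn ℂ Complex.Gamma {z | 0 < z.re} := fun z (hz : 0 < z.re) =>
    (Complex.differentiableAt_Gamma z fun m h => by
      rw [h] at hz; simp at hz; linarith [m.cast_nonneg (α := ℝ)]).differentiableWithinAt
  have ho : IsOpen {z : ℂ | 0 < z.re} := isOpen_lt continuous_const Complex.continuous_re
  intro x hx
  have hc : ContDiffAt ℂ ∞ Complex.Gamma (x : ℂ) :=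
    (hd.analyticAt (ho.mem_nhds (by simpa using hx))).contDiffAt
  have h := hc.real_of_complex
  simp only [Complex.Gamma_ofReal, Complex.ofReal_re] at h
  exact h.contDiffWithinAt

theorem contDiffOn_log_Gamma : ContDiffOn ℝ ∞ (fun y => Real.log (Real.Gamma y)) (Ioi 0) :=
  contDiffOn_real_Gamma.log fun _ hx => (Real.Gamma_pos_of_pos hx).ne'

theorem contDiffOn_psi : ContDiffOn ℝ ∞ psi (Ioi 0) :=
  contDiffOn_log_Gamma.deriv_of_isOpen isOpen_Ioi (by simp)

theorem psi_add_one {x : ℝ} (hx : 0 < x) : psi (x + 1) = psi x + 1 / x := by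
  have h := Complex.digamma_apply_add_one (x : ℂ) fun m h => by
    have : x = -(m : ℝ) := by exact_mod_cast h
    linarith [m.cast_nonneg (α := ℝ)]
  rw [← psi_eq_digamma hx, ← Complex.ofReal_one, ← Complex.ofReal_add,
    ← psi_eq_digamma (by positivity : 0 < x + 1)] at h
  rw [one_div]
  exact_mod_cast h

theorem psi_add_natCast {x : ℝ} (hx : 0 < x) (n : ℕ) :
    psi (x + n) = psi x + ∑ k ∈ Finset.range n, 1 / (x + k) := by
  induction n with
  | zero => simp
  | succ n ih =>
    rw [Nat.cast_succ, ← add_assoc, psi_add_one (by positivity), ih, Finset.sum_range_succ]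
    ring

theorem monotoneOn_psi : MonotoneOn psi (Ioi 0) :=
  Real.convexOn_log_Gamma.monotoneOn_deriv fun _ hx =>
    (contDiffOn_log_Gamma.differentiableOn (by simp)).differentiableAt (Ioi_mem_nhds hx)

/-- By monotonicity `y` may be replaced by `x + m` with an integer `m ≥ y - x`; the recurrence then
leaves `m` terms, each at most `1 / (x + n)`. -/
theorem tendsto_psi_sub_psi {x y : ℝ} (hx : 0 < x) (hxy : x ≤ y) :
    Tendsto (fun n : ℕ => psi (y + n) - psi (x + n)) atTop (𝓝 0) := by
  obtain ⟨m, hm⟩ := exists_nat_ge (y - x)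
  have hlim : Tendsto (fun n : ℕ => (m : ℝ) * (1 / (x + n))) atTop (𝓝 0) := by
    have h : Tendsto (fun n : ℕ => x + (n : ℝ)) atTop atTop :=
      tendsto_atTop_add_const_left _ _ tendsto_natCast_atTop_atTop
    simpa using (h.inv_tendsto_atTop).const_mul (m : ℝ)
  refine squeeze_zero (fun n => ?_) (fun n => ?_) hlim
  · have hxn : 0 < x + n := by positivity
    exact sub_nonneg.2 (monotoneOn_psi hxn (show 0 < y + n by linarith) (by linarith))
  · have hxn : 0 < x + n := by positivity
    have h1 : psi (y + n) ≤ psi (x + n + m) :=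
      monotoneOn_psi (show 0 < y + n by linarith) (show 0 < x + n + m by positivity) (by linarith)
    have h2 : ∑ k ∈ Finset.range m, 1 / (x + n + k) ≤ m * (1 / (x + n)) := by
      rw [← nsmul_eq_mul]
      refine (Finset.sum_le_card_nsmul _ _ (1 / (x + n)) fun k _ => ?_).trans_eq (by simp)
      exact one_div_le_one_div_of_le hxn (by linarith [k.cast_nonneg (α := ℝ)])
    rw [psi_add_natCast hxn] at h1
    linarith

theorem hasSum_psi_sub_psi {x y : ℝ} (hx : 0 < x) (hxy : x ≤ y) :
    HasSum (fun k : ℕ => 1 / (x + k) - 1 / (y + k)) (psi y - psi x) := by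
  rw [hasSum_iff_tendsto_nat_of_nonneg]
  · have h := (tendsto_psi_sub_psi hx hxy).const_sub (psi y - psi x)
    rw [sub_zero] at h
    refine h.congr fun n => ?_
    rw [psi_add_natCast hx, psi_add_natCast (hx.trans_le hxy), Finset.sum_sub_distrib]
    ring
  · intro k
    exact sub_nonneg.2 (one_div_le_one_div_of_le (by positivity) (by linarith))

theorem psi_sub_psi_pos {x y : ℝ} (hx : 0 < x) (hxy : x < y) : 0 < psi y - psi x := by
  have hs := hasSum_psi_sub_psi hx hxy.le
  have hy := hx.trans hxy
  rw [← hs.tsum_eq]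
  refine hs.summable.tsum_pos (fun k => ?_) 0 ?_
  · exact sub_nonneg.2 (one_div_le_one_div_of_le (by positivity) (by linarith))
  · simpa using inv_strictAnti₀ hx hxy

/-! ### Log-convexity of `sinh (l t) / sinh t` -/

/-- The difference of the two sides vanishes at `0` and has derivative `(l² - 1) sinh (l t) sinh t ≥
0`. -/
theorem sinh_mul_mul_cosh_le {l t : ℝ} (hl : 1 ≤ l) (ht : 0 ≤ t) :
    Real.sinh (l * t) * Real.cosh t ≤ l * (Real.cosh (l * t) * Real.sinh t) := by
  have hd : ∀ s : ℝ, HasDerivAt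
      (fun s => l * (Real.cosh (l * s) * Real.sinh s) - Real.sinh (l * s) * Real.cosh s)
      ((l ^ 2 - 1) * (Real.sinh (l * s) * Real.sinh s)) s := by
    intro s
    have hm : HasDerivAt (fun s => l * s) l s := by simpa using (hasDerivAt_id s).const_mul l
    exact (((hm.cosh.mul (Real.hasDerivAt_sinh s)).const_mul l).sub
      (hm.sinh.mul (Real.hasDerivAt_cosh s))).congr_deriv (by ring)
  have hmono : MonotoneOn
      (fun s => l * (Real.cosh (l * s) * Real.sinh s) - Real.sinh (l * s) * Real.cosh s) (Ici 0) := by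
    refine monotoneOn_of_deriv_nonneg (convex_Ici 0)
      (fun s _ => (hd s).continuousAt.continuousWithinAt)
      (fun s _ => (hd s).differentiableAt.differentiableWithinAt) fun s hs => ?_
    rw [interior_Ici] at hs
    have hs0 : 0 < s := hs
    rw [(hd s).deriv]
    have h1 : 0 ≤ Real.sinh (l * s) := Real.sinh_nonneg_iff.2 (by positivity)
    have h2 : 0 ≤ Real.sinh s := Real.sinh_nonneg_iff.2 hs0.le
    have h3 : 0 ≤ l ^ 2 - 1 := by nlinarith
    positivity
  have h := hmono (mem_Ici.2 le_rfl) (mem_Ici.2 ht) ht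
  simp only [mul_zero, Real.sinh_zero, zero_mul, sub_zero] at h
  linarith

theorem monotoneOn_sinh_mul_div_sinh {l : ℝ} (hl : 1 ≤ l) :
    MonotoneOn (fun t => Real.sinh (l * t) / Real.sinh t) (Ioi 0) := by
  have hne : ∀ t : ℝ, 0 < t → Real.sinh t ≠ 0 := fun t ht => (Real.sinh_pos_iff.2 ht).ne'
  have hd : ∀ t : ℝ, 0 < t → HasDerivAt (fun t => Real.sinh (l * t) / Real.sinh t)
      ((Real.cosh (l * t) * l * Real.sinh t - Real.sinh (l * t) * Real.cosh t) / Real.sinh t ^ 2) t := by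
    intro t ht
    have hm : HasDerivAt (fun s => l * s) l t := by simpa using (hasDerivAt_id t).const_mul l
    exact hm.sinh.div (Real.hasDerivAt_sinh t) (hne t ht)
  refine monotoneOn_of_deriv_nonneg (convex_Ioi 0)
    (fun t ht => (hd t ht).continuousAt.continuousWithinAt)
    (fun t ht => ?_) fun t ht => ?_
  · rw [interior_Ioi] at ht
    exact (hd t ht).differentiableAt.differentiableWithinAt
  · rw [interior_Ioi] at ht
    rw [(hd t ht).deriv]
    refine div_nonneg ?_ (sq_nonneg _)
    linarith [sinh_mul_mul_cosh_le hl (le_of_lt ht)]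

theorem sinh_sub_mul_sinh_add (x y : ℝ) :
    Real.sinh (x - y) * Real.sinh (x + y) = Real.sinh x ^ 2 - Real.sinh y ^ 2 := by
  rw [Real.sinh_sub, Real.sinh_add]
  nlinarith [Real.cosh_sq x, Real.cosh_sq y]

/-- Through `sinh (x-y) sinh (x+y) = sinh² x - sinh² y`, the claim reduces to the squared
monotonicity of the ratio between `s` and `t`. -/
theorem sq_sinh_ratio_le {l s t : ℝ} (hl : 1 ≤ l) (hs : 0 < s) (hst : s < t) :
    (Real.sinh (l * t) / Real.sinh t) ^ 2 ≤
      Real.sinh (l * (t - s)) / Real.sinh (t - s) * (Real.sinh (l * (t + s)) / Real.sinh (t + s)) := by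
  have ht := hs.trans hst
  have h := monotoneOn_sinh_mul_div_sinh hl (mem_Ioi.2 hs) (mem_Ioi.2 ht) hst.le
  simp only at h
  have hs' := Real.sinh_pos_iff.2 hs
  have ht' := Real.sinh_pos_iff.2 ht
  have hls := Real.sinh_pos_iff.2 (by positivity : 0 < l * s)
  have hlt := Real.sinh_pos_iff.2 (by positivity : 0 < l * t)
  rw [div_le_div_iff₀ hs' ht'] at h
  have hpos : 0 < Real.sinh (t - s) * Real.sinh (t + s) :=
    mul_pos (Real.sinh_pos_iff.2 (by linarith)) (Real.sinh_pos_iff.2 (by linarith))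
  rw [div_mul_div_comm, div_pow, div_le_div_iff₀ (by positivity) hpos, mul_sub, mul_add,
    sinh_sub_mul_sinh_add, sinh_sub_mul_sinh_add]
  have := pow_le_pow_left₀ (by positivity) h 2
  nlinarith

/-- The degenerate case `s = t` of `sq_sinh_ratio_le`, with the limit `l` in place of the ratio at
`0`; it serves the index `n = 0` of `psiDensity_logConvex`. -/
theorem sq_sinh_ratio_le_mul_two {l t : ℝ} (hl : 1 ≤ l) (ht : 0 < t) :
    (Real.sinh (l * t) / Real.sinh t) ^ 2 ≤ l * (Real.sinh (l * (2 * t)) / Real.sinh (2 * t)) := by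
  have ht' := Real.sinh_pos_iff.2 ht
  have hlt := Real.sinh_pos_iff.2 (by positivity : 0 < l * t)
  have hc := Real.cosh_pos t
  rw [show l * (2 * t) = 2 * (l * t) by ring, Real.sinh_two_mul, Real.sinh_two_mul, ← mul_div_assoc,
    div_pow, div_le_div_iff₀ (by positivity) (by positivity)]
  have h := mul_le_mul_of_nonneg_left (sinh_mul_mul_cosh_le hl ht.le)
    (by positivity : 0 ≤ 2 * (Real.sinh t * Real.sinh (l * t)))
  linarith

/-! ### The Laplace density: positivity, log-convexity, monotonicity -/

/-- `t ↦ e^{-bt} (1 - e^{-lt}) / (1 - e^{-t})`, extended continuously to `t = 0`: the density whose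
Laplace transform is `ψ(x + b + l) - ψ(x + b)`. -/
noncomputable def psiDensity (b l t : ℝ) : ℝ :=
  if t = 0 then l else Real.exp (-(b * t)) * ((1 - Real.exp (-(l * t))) / (1 - Real.exp (-t)))

theorem one_sub_exp_neg (t : ℝ) :
    1 - Real.exp (-t) = 2 * Real.exp (-(t / 2)) * Real.sinh (t / 2) := by
  rw [Real.sinh_eq]
  have h1 : Real.exp (-(t / 2)) * Real.exp (t / 2) = 1 := by rw [← Real.exp_add]; simp
  have h2 : Real.exp (-(t / 2)) * Real.exp (-(t / 2)) = Real.exp (-t) := by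
    rw [← Real.exp_add]; ring_nf
  linear_combination h2 - h1

/-- The exponential factor is log-linear, so log-convexity is a matter of the `sinh` ratio alone. -/
theorem psiDensity_eq_sinh (b l : ℝ) {t : ℝ} (ht : 0 < t) :
    psiDensity b l t = Real.exp (-((b + (l - 1) / 2) * t)) *
      (Real.sinh (l * (t / 2)) / Real.sinh (t / 2)) := by
  have hs := Real.sinh_pos_iff.2 (half_pos ht)
  rw [psiDensity, if_neg ht.ne', one_sub_exp_neg, one_sub_exp_neg,
    show l * (t / 2) = l * t / 2 by ring,
    show -((b + (l - 1) / 2) * t) = -(b * t) + (-(l * t / 2) - -(t / 2)) by ring, Real.exp_add,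
    Real.exp_sub]
  field_simp

theorem psiDensity_pos (b : ℝ) {l t : ℝ} (hl : 0 < l) (ht : 0 ≤ t) : 0 < psiDensity b l t := by
  rcases ht.eq_or_lt with rfl | ht
  · simpa [psiDensity]
  · rw [psiDensity_eq_sinh b l ht]
    exact mul_pos (Real.exp_pos _) (div_pos (Real.sinh_pos_iff.2 (by positivity))
      (Real.sinh_pos_iff.2 (by positivity)))

theorem psiDensity_logConvex (b : ℝ) {l ε : ℝ} (hl : 1 ≤ l) (hε : 0 < ε) (n : ℕ) :
    psiDensity b l ((n + 1 : ℕ) * ε) ^ 2 ≤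
      psiDensity b l (n * ε) * psiDensity b l ((n + 2 : ℕ) * ε) := by
  rw [psiDensity_eq_sinh b l (by positivity), psiDensity_eq_sinh b l (t := (n + 2 : ℕ) * ε)
    (by positivity), mul_pow, ← Real.exp_nat_mul]
  rcases Nat.eq_zero_or_pos n with rfl | hn
  · have h := sq_sinh_ratio_le_mul_two hl (half_pos hε)
    have he : Real.exp ((2 : ℕ) * -((b + (l - 1) / 2) * ((0 + 1 : ℕ) * ε))) =
        Real.exp (-((b + (l - 1) / 2) * ((0 + 2 : ℕ) * ε))) := by
      congr 1; push_cast; ring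
    have h0 : psiDensity b l ((0 : ℕ) * ε) = l := by simp [psiDensity]
    rw [he, h0]
    refine (mul_le_mul_of_nonneg_left ?_ (Real.exp_pos _).le).trans_eq (mul_left_comm _ _ _)
    simpa [mul_div_assoc, mul_div_cancel₀] using h
  · have hn' : (1 : ℝ) ≤ n := by exact_mod_cast hn
    rw [psiDensity_eq_sinh b l (by positivity), mul_mul_mul_comm, ← Real.exp_add]
    have he : ((2 : ℕ) : ℝ) * -((b + (l - 1) / 2) * ((n + 1 : ℕ) * ε)) =
        -((b + (l - 1) / 2) * (n * ε)) + -((b + (l - 1) / 2) * ((n + 2 : ℕ) * ε)) := by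
      push_cast; ring
    rw [he]
    refine mul_le_mul_of_nonneg_left ?_ (Real.exp_pos _).le
    have h := sq_sinh_ratio_le (s := ε / 2) (t := (n + 1 : ℕ) * ε / 2) hl (by positivity)
      (by push_cast; nlinarith)
    rwa [show ((n + 1 : ℕ) : ℝ) * ε / 2 - ε / 2 = n * ε / 2 by push_cast; ring,
      show ((n + 1 : ℕ) : ℝ) * ε / 2 + ε / 2 = (n + 2 : ℕ) * ε / 2 by push_cast; ring] at h

theorem psiDensity_le {b l t : ℝ} (hb : 0 ≤ b) (hl : 1 ≤ l) (ht : 0 ≤ t) :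
    psiDensity b l t ≤ l := by
  rcases ht.eq_or_lt with rfl | ht
  · simp [psiDensity]
  have hv : 0 < 1 - Real.exp (-t) := by simpa using ht
  -- Bernoulli's inequality for `(e^{-t})^l`.
  have hbern := one_add_mul_self_le_rpow_one_add (s := Real.exp (-t) - 1)
    (by linarith [Real.exp_pos (-t)]) hl
  rw [add_sub_cancel, ← Real.exp_mul] at hbern
  rw [psiDensity, if_neg ht.ne']
  have h1 : (1 - Real.exp (-(l * t))) / (1 - Real.exp (-t)) ≤ l := by
    rw [div_le_iff₀ hv, show -(l * t) = -t * l by ring]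
    linarith
  have h2 : Real.exp (-(b * t)) ≤ 1 := Real.exp_le_one_iff.2 (neg_nonpos.2 (by positivity))
  have h3 : 0 ≤ (1 - Real.exp (-(l * t))) / (1 - Real.exp (-t)) := by
    refine div_nonneg ?_ hv.le
    simpa using (by positivity : 0 ≤ l * t)
  nlinarith

theorem psiDensity_antitoneOn {b l : ℝ} (hb : 0 ≤ b) (hl : 1 ≤ l) :
    AntitoneOn (psiDensity b l) (Ici 0) := by
  intro s hs t ht hst
  rcases (mem_Ici.1 hs).eq_or_lt with rfl | hs0
  · exact (psiDensity_le hb hl ht).trans_eq (by simp [psiDensity])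
  have ht0 : 0 < t := hs0.trans_le hst
  rw [psiDensity, psiDensity, if_neg hs0.ne', if_neg ht0.ne']
  have hvs : Real.exp (-s) < 1 := by simpa using hs0
  have hvt : Real.exp (-t) < 1 := by simpa using ht0
  -- The quotient is the slope of the secant of the convex function `v ↦ v^l` from `1` to `v =
  -- e^{-t}`, and `v` decreases with `t`.
  have h := (convexOn_rpow hl).secant_mono (a := 1) (x := Real.exp (-t)) (y := Real.exp (-s))
    (by simp) (Real.exp_pos _).le (Real.exp_pos _).le hvt.ne hvs.ne
    (Real.exp_le_exp.2 (neg_le_neg hst))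
  rw [Real.one_rpow, ← Real.exp_mul, ← Real.exp_mul, ← neg_div_neg_eq, neg_sub, neg_sub,
    ← neg_div_neg_eq (_ - _) (Real.exp (-s) - 1), neg_sub, neg_sub,
    show -t * l = -(l * t) by ring, show -s * l = -(l * s) by ring] at h
  refine mul_le_mul (Real.exp_le_exp.2 ?_) h ?_ (Real.exp_pos _).le
  · exact neg_le_neg (mul_le_mul_of_nonneg_left hst hb)
  · refine div_nonneg ?_ (sub_nonneg.2 hvt.le)
    simpa using (by positivity : 0 ≤ l * t)

/-! ### Discretisation of `1 / y` -/

/-- Since `e^t / (e^t - 1)² = 1 / (2 sinh (t/2))²`, the sign of the derivative follows from `sinh u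
≥ u`. After scaling by `ε` this yields the dominating bound `discreteInv_sub_le`. -/
theorem antitoneOn_inv_sub_inv_exp_sub_one :
    AntitoneOn (fun s : ℝ => 1 / s - 1 / (Real.exp s - 1)) (Ioi 0) := by
  have hpos : ∀ s : ℝ, 0 < s → 0 < Real.exp s - 1 := fun s hs => by simpa using hs
  have hd : ∀ s : ℝ, 0 < s → HasDerivAt (fun s : ℝ => 1 / s - 1 / (Real.exp s - 1))
      (-(s ^ 2)⁻¹ - -Real.exp s / (Real.exp s - 1) ^ 2) s := by
    intro s hs
    have h := (hasDerivAt_inv hs.ne').sub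
      (((Real.hasDerivAt_exp s).sub_const 1).inv (hpos s hs).ne')
    simp only [one_div]
    exact h
  refine antitoneOn_of_deriv_nonpos (convex_Ioi 0)
    (fun t ht => (hd t ht).continuousAt.continuousWithinAt) (fun t ht => ?_) fun t ht => ?_
  · rw [interior_Ioi] at ht
    exact (hd t ht).differentiableAt.differentiableWithinAt
  · rw [interior_Ioi] at ht
    have ht0 : 0 < t := ht
    rw [(hd t ht).deriv]
    have hs : t / 2 ≤ Real.sinh (t / 2) := Real.self_le_sinh_iff.2 (by positivity)
    have he : Real.exp t - 1 = Real.exp t * (2 * Real.exp (-(t / 2)) * Real.sinh (t / 2)) := by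
      rw [← one_sub_exp_neg, mul_sub, ← Real.exp_add]
      simp
    have h2 : Real.exp (-(t / 2)) ^ 2 * Real.exp t = 1 := by
      rw [← Real.exp_nat_mul, ← Real.exp_add, Real.exp_eq_one_iff]
      push_cast; ring
    have h3 : (Real.exp t - 1) ^ 2 = Real.exp t * (2 * Real.sinh (t / 2)) ^ 2 := by
      rw [he]
      linear_combination Real.exp t * (2 * Real.sinh (t / 2)) ^ 2 * h2
    have h4 : t ^ 2 ≤ (2 * Real.sinh (t / 2)) ^ 2 :=
      pow_le_pow_left₀ ht0.le (by linarith) 2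
    have h5 : Real.exp t / (Real.exp t - 1) ^ 2 ≤ (t ^ 2)⁻¹ := by
      rw [h3, ← div_div, div_self (Real.exp_pos t).ne', one_div]
      exact inv_anti₀ (by positivity) h4
    rw [neg_div]
    linarith

/-- The discretisation `ε / (e^{εy} - 1)` of `1 / y`. -/
noncomputable def discreteInv (ε y : ℝ) : ℝ := ε / (Real.exp (ε * y) - 1)

theorem discreteInv_anti {ε y w : ℝ} (hε : 0 < ε) (hy : 0 < y) (hyw : y ≤ w) :
    discreteInv ε w ≤ discreteInv ε y := by
  have h : 0 < Real.exp (ε * y) - 1 := by simpa using mul_pos hε hy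
  refine div_le_div_of_nonneg_left hε.le h (sub_le_sub_right (Real.exp_le_exp.2 ?_) 1)
  exact mul_le_mul_of_nonneg_left hyw hε.le

theorem discreteInv_sub_le {ε y w : ℝ} (hε : 0 < ε) (hy : 0 < y) (hyw : y ≤ w) :
    discreteInv ε y - discreteInv ε w ≤ 1 / y - 1 / w := by
  have hw := hy.trans_le hyw
  have h := mul_le_mul_of_nonneg_left (antitoneOn_inv_sub_inv_exp_sub_one
    (mem_Ioi.2 (mul_pos hε hy)) (mem_Ioi.2 (mul_pos hε hw))
    (mul_le_mul_of_nonneg_left hyw hε.le)) hε.le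
  have h1 : ε * (1 / (ε * y)) = 1 / y := by field_simp
  have h2 : ε * (1 / (ε * w)) = 1 / w := by field_simp
  simp only [mul_sub, h1, h2, mul_one_div ε (Real.exp _ - 1)] at h
  rw [discreteInv, discreteInv]
  linarith

theorem tendsto_discreteInv {y : ℝ} (hy : 0 < y) :
    Tendsto (fun ε => discreteInv ε y) (𝓝[>] 0) (𝓝 (1 / y)) := by
  have hd : HasDerivAt (fun ε => Real.exp (ε * y)) y 0 := by
    have hm : HasDerivAt (fun ε => ε * y) y 0 := by simpa using (hasDerivAt_id (0 : ℝ)).mul_const y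
    simpa using hm.exp
  have h := hd.tendsto_slope_zero_right.inv₀ hy.ne'
  rw [one_div]
  refine h.congr fun ε => ?_
  simp [discreteInv, div_eq_mul_inv, mul_comm]

theorem hasSum_discreteInv {ε y : ℝ} (hε : 0 < ε) (hy : 0 < y) :
    HasSum (fun n : ℕ => ε * Real.exp (-(y * ((n + 1 : ℕ) * ε)))) (discreteInv ε y) := by
  have hr : Real.exp (-(ε * y)) < 1 := by simpa using mul_pos hε hy
  have h := (hasSum_geometric_of_lt_one (Real.exp_pos _).le hr).mul_left
    (ε * Real.exp (-(ε * y)))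
  have hval : ε * Real.exp (-(ε * y)) * (1 - Real.exp (-(ε * y)))⁻¹ = discreteInv ε y := by
    have h1 : 0 < Real.exp (ε * y) - 1 := by simpa using mul_pos hε hy
    rw [discreteInv, Real.exp_neg]
    have h2 := Real.exp_pos (ε * y)
    have h3 : 1 - (Real.exp (ε * y))⁻¹ = (Real.exp (ε * y) - 1) / Real.exp (ε * y) := by field_simp
    rw [h3]
    field_simp
  rw [hval] at h
  refine (congrArg (HasSum · _) (funext fun n => ?_)).mpr h
  rw [mul_assoc, ← Real.exp_nat_mul, ← Real.exp_add]
  push_cast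
  ring_nf

/-! ### Riemann sums of the Laplace transform and their limit -/

theorem hasSum_psiDensity {b l x t : ℝ} (ht : 0 < t) :
    HasSum (fun k : ℕ => Real.exp (-((x + b + k) * t)) - Real.exp (-((x + b + l + k) * t)))
      (psiDensity b l t * Real.exp (-(x * t))) := by
  have hr : Real.exp (-t) < 1 := by simpa using ht
  have h := (hasSum_geometric_of_lt_one (Real.exp_pos _).le hr).mul_left
    (Real.exp (-(x * t)) * Real.exp (-(b * t)) * (1 - Real.exp (-(l * t))))
  have hval : psiDensity b l t * Real.exp (-(x * t)) = Real.exp (-(x * t)) * Real.exp (-(b * t)) *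
      (1 - Real.exp (-(l * t))) * (1 - Real.exp (-t))⁻¹ := by
    rw [psiDensity, if_neg ht.ne']
    ring
  rw [hval]
  refine (congrArg (HasSum · _) (funext fun k => ?_)).mpr h
  rw [← Real.exp_nat_mul, mul_sub, mul_one, sub_mul, ← Real.exp_add, ← Real.exp_add,
    ← Real.exp_add, ← Real.exp_add]
  ring_nf

/-- The Riemann sum, of step `ε`, of the Laplace transform of `psiDensity b l`. -/
noncomputable def psiRiemannSum (b l ε x : ℝ) : ℝ :=
  ε * ∑' n : ℕ, psiDensity b l (n * ε) * Real.exp (-(ε * x)) ^ n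

theorem abs_psiDensity_le {b l ε : ℝ} (hb : 0 ≤ b) (hl : 1 ≤ l) (hε : 0 < ε) (n : ℕ) :
    |psiDensity b l (n * ε)| ≤ l := by
  rw [abs_of_pos (psiDensity_pos b (by linarith) (by positivity))]
  exact psiDensity_le hb hl (by positivity)

/-- The density expands as a geometric series away from `t = 0`, and nonnegativity allows the two
summations to be exchanged. The node `n = 0`, where that expansion fails, contributes `ε * l`. -/
theorem psiRiemannSum_eq {b l ε x : ℝ} (hb : 0 ≤ b) (hl : 1 ≤ l) (hε : 0 < ε) (hx : 0 < x) :
    psiRiemannSum b l ε x = ε * l +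
      ∑' k : ℕ, (discreteInv ε (x + b + k) - discreteInv ε (x + b + l + k)) := by
  have hz1 : Real.exp (-(ε * x)) < 1 := by simpa using mul_pos hε hx
  have hsum := (summable_mul_pow_of_abs_le (abs_psiDensity_le hb hl hε) (Real.exp_pos _).le
    hz1).of_norm
  let f : ℕ → ℕ → ℝ := fun k n => ε * Real.exp (-((x + b + k) * ((n + 1 : ℕ) * ε))) -
    ε * Real.exp (-((x + b + l + k) * ((n + 1 : ℕ) * ε)))
  have hrow : ∀ k, HasSum (f k) (discreteInv ε (x + b + k) - discreteInv ε (x + b + l + k)) :=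
    fun k => (hasSum_discreteInv hε (by positivity)).sub (hasSum_discreteInv hε (by positivity))
  have hcol : ∀ n, HasSum (fun k => f k n)
      (ε * (psiDensity b l ((n + 1 : ℕ) * ε) * Real.exp (-(ε * x)) ^ (n + 1))) := by
    intro n
    have h := (hasSum_psiDensity (b := b) (l := l) (x := x)
      (by positivity : 0 < ((n + 1 : ℕ) : ℝ) * ε)).mul_left ε
    rw [← Real.exp_nat_mul, show ((n + 1 : ℕ) : ℝ) * -(ε * x) = -(x * ((n + 1 : ℕ) * ε)) by ring]
    simpa only [f, mul_sub] using h
  have hf : Summable (Function.uncurry f) := by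
    rw [summable_prod_of_nonneg]
    · refine ⟨fun k => (hrow k).summable, ?_⟩
      have heq : (fun k => ∑' n, Function.uncurry f (k, n)) =
          fun k : ℕ => discreteInv ε (x + b + k) - discreteInv ε (x + b + l + k) :=
        funext fun k => (hrow k).tsum_eq
      rw [heq]
      refine Summable.of_nonneg_of_le (fun k => ?_) (fun k => ?_)
        (hasSum_psi_sub_psi (x := x + b) (y := x + b + l) (by positivity) (by linarith)).summable
      · exact sub_nonneg.2 (discreteInv_anti hε (by positivity) (by linarith))
      · exact discreteInv_sub_le hε (by positivity) (by linarith)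
    · rintro ⟨k, n⟩
      refine sub_nonneg.2 (mul_le_mul_of_nonneg_left (Real.exp_le_exp.2 (neg_le_neg ?_)) hε.le)
      exact mul_le_mul_of_nonneg_right (by linarith) (by positivity)
  rw [psiRiemannSum, hsum.tsum_eq_zero_add, mul_add, ← tsum_mul_left]
  congr 1
  · simp [psiDensity]
  · rw [← tsum_congr fun k => (hrow k).tsum_eq, ← hf.tsum_comm]
    exact tsum_congr fun n => (hcol n).tsum_eq.symm

theorem tendsto_psiRiemannSum {b l x : ℝ} (hb : 0 ≤ b) (hl : 1 ≤ l) (hx : 0 < x) :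
    Tendsto (fun ε => psiRiemannSum b l ε x) (𝓝[>] 0) (𝓝 (psi (x + b + l) - psi (x + b))) := by
  have hs := hasSum_psi_sub_psi (x := x + b) (y := x + b + l) (by positivity) (by linarith)
  have h1 : Tendsto (fun ε : ℝ => ε * l) (𝓝[>] 0) (𝓝 0) := by
    have : Tendsto (fun ε : ℝ => ε * l) (𝓝 0) (𝓝 (0 * l)) := tendsto_id.mul_const l
    rw [zero_mul] at this
    exact this.mono_left nhdsWithin_le_nhds
  have h2 : Tendsto (fun ε => ∑' k : ℕ, (discreteInv ε (x + b + k) - discreteInv ε (x + b + l + k)))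
      (𝓝[>] 0) (𝓝 (∑' k : ℕ, (1 / (x + b + k) - 1 / (x + b + l + k)))) := by
    refine tendsto_tsum_of_dominated_convergence hs.summable (fun k => ?_) ?_
    · exact (tendsto_discreteInv (by positivity)).sub (tendsto_discreteInv (by positivity))
    · filter_upwards [self_mem_nhdsWithin] with ε (hε : 0 < ε) k
      rw [Real.norm_of_nonneg (sub_nonneg.2 (discreteInv_anti hε (by positivity) (by linarith)))]
      exact discreteInv_sub_le hε (by positivity) (by linarith)
  have h := h1.add h2
  rw [zero_add, hs.tsum_eq] at h
  refine h.congr' ?_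
  filter_upwards [self_mem_nhdsWithin] with ε (hε : 0 < ε)
  exact (psiRiemannSum_eq hb hl hε hx).symm

/-! ### Reciprocals of the Riemann sums -/

section

variable {b l ε : ℝ}

theorem antitone_psiDensity_natCast_mul (hb : 0 ≤ b) (hl : 1 ≤ l) (hε : 0 < ε) :
    Antitone fun n : ℕ => psiDensity b l (n * ε) := fun m n hmn =>
  psiDensity_antitoneOn hb hl (mem_Ici.2 (by positivity)) (mem_Ici.2 (by positivity))
    (mul_le_mul_of_nonneg_right (by exact_mod_cast hmn) hε.le)

theorem hasSum_inv_psiRiemannSum (hb : 0 ≤ b) (hl : 1 ≤ l) (hε : 0 < ε) {x : ℝ} (hx : 0 < x) :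
    HasSum (fun n : ℕ => ε⁻¹ * invCoeff (fun n : ℕ => psiDensity b l (n * ε)) n *
      Real.exp (-(n * ε * x))) (psiRiemannSum b l ε x)⁻¹ := by
  have hz1 : Real.exp (-(ε * x)) < 1 := by simpa using mul_pos hε hx
  have h := (hasSum_invCoeff (fun n => psiDensity_pos b (by linarith) (by positivity))
    (psiDensity_logConvex b hl hε) (antitone_psiDensity_natCast_mul hb hl hε)
    (Real.exp_pos _).le hz1).mul_left ε⁻¹
  rw [← mul_inv] at h
  refine (congrArg (HasSum · _) (funext fun n => ?_)).mpr h
  rw [← Real.exp_nat_mul, mul_assoc, show -((n : ℝ) * ε * x) = n * -(ε * x) by ring]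

/-- The increment removes the constant term, the only positive coefficient, and leaves decaying
exponentials with nonnegative weights `-c n * (1 - e^{-nεδ}) / ε`. -/
theorem altDiffNonneg_inv_psiRiemannSum_increment (hb : 0 ≤ b) (hl : 1 ≤ l) (hε : 0 < ε) {δ : ℝ}
    (hδ : 0 < δ) (m : ℕ) : AltDiffNonneg m
      (fun x => (psiRiemannSum b l ε (x + δ))⁻¹ - (psiRiemannSum b l ε x)⁻¹) := by
  set c := invCoeff (fun n : ℕ => psiDensity b l (n * ε)) with hc
  have hterm : ∀ n : ℕ, AltDiffNonneg m (fun x => ε⁻¹ * c n * Real.exp (-(n * ε * (x + δ))) -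
      ε⁻¹ * c n * Real.exp (-(n * ε * x))) := by
    intro n
    have hn : 0 ≤ ε⁻¹ * (-c n * (1 - Real.exp (-(n * ε * δ)))) := by
      rcases n with _ | n
      · simp
      · refine mul_nonneg (by positivity) (mul_nonneg ?_ ?_)
        · exact neg_nonneg.2 (invCoeff_succ_nonpos
            (fun n => psiDensity_pos b (by linarith) (by positivity))
            (psiDensity_logConvex b hl hε) n)
        · exact sub_nonneg.2 (Real.exp_le_one_iff.2 (neg_nonpos.2 (by positivity)))
    refine ((AltDiffNonneg.exp_neg_mul m (s := n * ε) (by positivity)).const_mul hn).congr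
      fun x _ => ?_
    rw [mul_add (n * ε), neg_add, Real.exp_add]
    ring
  exact AltDiffNonneg.of_hasSum hterm fun x hx =>
    (hasSum_inv_psiRiemannSum hb hl hε (by positivity)).sub (hasSum_inv_psiRiemannSum hb hl hε hx)

/-- The factor `ε / (1 - e^{-εx})` is a discrete `1 / x` chosen as a geometric series, so the
product has the partial sums of `invCoeff` as coefficients. -/
theorem altDiffNonneg_inv_psiRiemannSum_div_one_sub_exp (hb : 0 ≤ b) (hl : 1 ≤ l) (hε : 0 < ε)
    (m : ℕ) : AltDiffNonneg m
      (fun x => (psiRiemannSum b l ε x)⁻¹ * (ε / (1 - Real.exp (-(ε * x))))) := by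
  have hpos : ∀ n : ℕ, 0 < psiDensity b l (n * ε) :=
    fun n => psiDensity_pos b (by linarith) (by positivity)
  have hlog := psiDensity_logConvex b hl hε
  have hanti := antitone_psiDensity_natCast_mul hb hl hε
  refine AltDiffNonneg.of_hasSum (fun n : ℕ => (AltDiffNonneg.exp_neg_mul m (s := n * ε)
    (by positivity)).const_mul (sum_range_invCoeff_nonneg hpos hlog hanti n)) fun x hx => ?_
  have hz1 : Real.exp (-(ε * x)) < 1 := by simpa using mul_pos hε hx
  have h := hasSum_sum_range_invCoeff hpos hlog hanti (Real.exp_pos _).le hz1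
  convert h using 1
  · funext n
    rw [← Real.exp_nat_mul, show -((n : ℝ) * ε * x) = n * -(ε * x) by ring]
  · rw [psiRiemannSum]
    field_simp

theorem tendsto_div_one_sub_exp {x : ℝ} (hx : 0 < x) :
    Tendsto (fun ε => ε / (1 - Real.exp (-(ε * x)))) (𝓝[>] 0) (𝓝 (1 / x)) := by
  have h : Tendsto (fun ε : ℝ => Real.exp (ε * x)) (𝓝[>] 0) (𝓝 1) := by
    have : Continuous fun ε : ℝ => Real.exp (ε * x) := by fun_prop
    simpa using (this.tendsto 0).mono_left nhdsWithin_le_nhds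
  have h2 := h.mul (tendsto_discreteInv hx)
  rw [one_mul] at h2
  refine h2.congr' ?_
  filter_upwards [self_mem_nhdsWithin] with ε (hε : 0 < ε)
  have h1 : 0 < Real.exp (ε * x) - 1 := by simpa using mul_pos hε hx
  have h2 := Real.exp_pos (ε * x)
  have h3 : 1 - (Real.exp (ε * x))⁻¹ = (Real.exp (ε * x) - 1) / Real.exp (ε * x) := by field_simp
  rw [discreteInv, Real.exp_neg, h3]
  field_simp

end

/-! ### Passage to the limit and conclusion -/

theorem altDiffNonneg_inv_psi_sub_psi_increment {b l δ : ℝ} (hb : 0 ≤ b) (hl : 1 ≤ l) (hδ : 0 < δ)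
    (m : ℕ) : AltDiffNonneg m (fun x =>
      (psi (x + δ + b + l) - psi (x + δ + b))⁻¹ - (psi (x + b + l) - psi (x + b))⁻¹) := by
  have hlim : ∀ x, 0 < x → Tendsto (fun ε => (psiRiemannSum b l ε x)⁻¹) (𝓝[>] 0)
      (𝓝 (psi (x + b + l) - psi (x + b))⁻¹) := fun x hx =>
    (tendsto_psiRiemannSum hb hl hx).inv₀ (psi_sub_psi_pos (by positivity) (by linarith)).ne'
  refine AltDiffNonneg.of_tendsto (l := 𝓝[>] (0 : ℝ)) ?_
    fun x hx => (hlim (x + δ) (by positivity)).sub (hlim x hx)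
  filter_upwards [self_mem_nhdsWithin] with ε (hε : 0 < ε)
  exact altDiffNonneg_inv_psiRiemannSum_increment hb hl hε hδ m

theorem altDiffNonneg_inv_psi_sub_psi_div {b l : ℝ} (hb : 0 ≤ b) (hl : 1 ≤ l) (m : ℕ) :
    AltDiffNonneg m (fun x => (psi (x + b + l) - psi (x + b))⁻¹ * (1 / x)) := by
  refine AltDiffNonneg.of_tendsto (l := 𝓝[>] (0 : ℝ)) ?_ fun x hx =>
    ((tendsto_psiRiemannSum hb hl hx).inv₀
      (psi_sub_psi_pos (by positivity) (by linarith)).ne').mul (tendsto_div_one_sub_exp hx)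
  filter_upwards [self_mem_nhdsWithin] with ε (hε : 0 < ε)
  exact altDiffNonneg_inv_psiRiemannSum_div_one_sub_exp hb hl hε m

theorem contDiffOn_inv_psi_sub_psi {b l : ℝ} (hb : 0 ≤ b) (hl : 0 < l) :
    ContDiffOn ℝ ∞ (fun x => (psi (x + b + l) - psi (x + b))⁻¹) (Ioi 0) := by
  have h1 : ContDiffOn ℝ ∞ (fun x => psi (x + b + l)) (Ioi 0) :=
    contDiffOn_psi.comp (by fun_prop) fun x (hx : 0 < x) => show 0 < x + b + l by positivity
  have h2 : ContDiffOn ℝ ∞ (fun x => psi (x + b)) (Ioi 0) :=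
    contDiffOn_psi.comp (by fun_prop) fun x (hx : 0 < x) => show 0 < x + b by positivity
  exact (h1.sub h2).inv fun x (hx : 0 < x) =>
    (psi_sub_psi_pos (by positivity) (by linarith)).ne'

theorem mainTheorem9 (a b : ℝ) (hb : 0 < b) (hba : b < a - 1) :
    IsGeneralizedBernstein (a - b) (psiQuotient a b) := by
  obtain ⟨l, rfl⟩ : ∃ l, a = b + l := ⟨a - b, by ring⟩
  have hl : 1 < l := by linarith
  rw [add_sub_cancel_left]
  set G : ℝ → ℝ := fun x => (psi (x + b + l) - psi (x + b))⁻¹ with hG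
  have hGsmooth : ContDiffOn ℝ ∞ G (Ioi 0) := contDiffOn_inv_psi_sub_psi hb.le (by linarith)
  have hGd : ∀ x, 0 < x → DifferentiableAt ℝ G x := fun x hx =>
    (hGsmooth.differentiableOn (by simp)).differentiableAt (Ioi_mem_nhds hx)
  have hF : psiQuotient (b + l) b = fun x => x ^ (l - 1) * G x := by
    funext x
    rw [psiQuotient, hG, add_sub_cancel_left, div_eq_mul_inv, ← add_assoc]
  have hrpow : ContDiffOn ℝ ∞ (fun x : ℝ => x ^ (l - 1)) (Ioi 0) :=
    contDiffOn_id.rpow_const_of_ne fun x hx => (mem_Ioi.1 hx).ne'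
  have hderiv : ∀ x, 0 < x → deriv G x + (l - 1) * (G x * (1 / x)) =
      x ^ (1 - l) * deriv (psiQuotient (b + l) b) x := by
    intro x hx
    rw [hF, ((Real.hasDerivAt_rpow_const (Or.inl hx.ne')).fun_mul (hGd x hx).hasDerivAt).deriv]
    have h1 : x ^ (1 - l) * x ^ (l - 1) = 1 := by rw [← Real.rpow_add hx]; simp
    rw [Real.rpow_sub_one hx.ne' (l - 1)]
    linear_combination (-(l - 1) * G x / x - deriv G x) * h1
  have hFsmooth : ContDiffOn ℝ ∞ (psiQuotient (b + l) b) (Ioi 0) := hF ▸ hrpow.mul hGsmooth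
  refine ⟨by linarith, hFsmooth, fun x hx => ?_, ?_⟩
  · rw [hF]
    exact mul_pos (Real.rpow_pos_of_pos hx _)
      (inv_pos.2 (psi_sub_psi_pos (by positivity) (by linarith)))
  · refine isCompletelyMonotonic_of_altDiffNonneg ?_ fun m => ?_
    · exact (contDiffOn_id.rpow_const_of_ne fun x hx => (mem_Ioi.1 hx).ne').mul
        (hFsmooth.deriv_of_isOpen isOpen_Ioi (by simp))
    · refine AltDiffNonneg.congr ?_ hderiv
      refine AltDiffNonneg.add ?_
        ((altDiffNonneg_inv_psi_sub_psi_div hb.le hl.le m).const_mul (by linarith))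
      exact AltDiffNonneg.deriv_of_increments
        (fun δ hδ => altDiffNonneg_inv_psi_sub_psi_increment hb.le hl.le hδ m) hGd
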